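/- Let $\mathcal L$ be a first-order signature (relation, function and constant symbols, equality being part of the logic) over the countable set of variables $\mathsf{Var}$, and let $\mathrm{D.FO}$ be the following multi-type display calculus. There is one type for each finite $F\subseteq\mathsf{Var}$. For a family of terms $t_{F'}=(t_v)_{v\in F'}$ let $\mathsf{FV}(t_{F'})$ be the set of variables occurring in it. The $F$-formulas are $$A^F::=R(\bar t)\mid s=t\mid\top_F\mid\bot_F\mid A^F\wedge A^F\mid A^F\vee A^F\mid A^F\to A^F\mid[y]A^{F\cup\{y\}}\mid\langle y\rangle A^{F\cup\{y\}}\mid(x)A^{F\setminus\{x\}}\mid(t_{F'})A^{F'},$$ where the atoms have $F$ as their set of free variables, $y\notin F$, $x\in F$ and $\mathsf{FV}(t_{F'})=F$. Structures of type $F$ are built from $F$-formulas with the structural connectives: in precedent position $\hat\top_F$, $\hat R(\bar t)$, $s\,\hat=\,t$, $X\,\hat\wedge\,Y$, the left and right residuals $X\,\hat>\,Y$ and $X\,\hat<\,Y$ of $\check\vee$, $\langle\hat x\rangle X$, $(\tilde x)X$, $(\tilde t_{F'})X$, $\langle\hat t_{F'}\rangle X$; in succedent position $\check\bot_F$, $X\,\check\vee\,Y$,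 $X\,\check\to\,Y$, $X\,\check\leftarrow\,Y$, $[\check x]X$, $(\tilde x)X$, $(\tilde t_{F'})X$, $[\check t_{F'}]X$. Sequents are $X\vdash_F Y$ with $X$ a precedent and $Y$ a succedent structure of type $F$. The rules of $\mathrm{D.FO}$, in which every sequent has to be well-typed, are the following ($P/C$ has premise(s) $P$ and conclusion $C$; $P/\!/C$ may be used in both directions). 1. Axioms: $\hat R(\bar t)\vdash R(\bar t)$, $\;s\,\hat=\,t\vdash s=t$, $\;\bot\vdash\check\bot$, $\;\hat\top\vdash\top$. Cut: $X\vdash_F A,\ A\vdash_F Y\,/\,X\vdash_F Y$. 2. Display postulates: $X\hat\wedge Y\vdash Z/\!/Y\vdash X\check\to Z$; $X\hat\wedge Y\vdash Z/\!/X\vdash Z\check\leftarrow Y$; $Z\vdash X\check\vee Y/\!/X\hat> Z\vdash Y$; $Z\vdash X\check\vee Y/\!/Z\hat< Y\vdash X$; $X\vdash_{F\cup\{x\}}(\tilde x)Y/\!/\langle\hat x\rangle X\vdash_{F\setminus\{x\}}Y$; $(\tilde x)Y\vdash_{F\cup\{x\}}X/\!/Y\vdash_{F\setminus\{x\}}[\check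 x]X$; and, with $\mathsf{FV}(t_F)=F'$, $Y\vdash_{F'}(\tilde t_F)X/\!/\langle\hat t_F\rangle Y\vdash_F X$; $(\tilde t_F)X\vdash_{F'}Y/\!/X\vdash_F[\check t_F]Y$. 3. Adjunction rules: $(\tilde x)\langle\hat x\rangle X\vdash Y/X\vdash Y$; $(\tilde t_{F'})\langle\hat t_{F'}\rangle X\vdash Y/X\vdash Y$. 4. Necessitation: for $\star=x$ or $\star=t_{F'}$, $\hat\top\vdash X/\!/(\tilde\star)\hat\top\vdash X$ and $X\vdash\check\bot/\!/X\vdash(\tilde\star)\check\bot$. 5. Atomic structural rule: $(\tilde s_{T_1})\cdots(\tilde s_{T_m})\hat b\vdash X\,/\,(\tilde t_{F_1})\cdots(\tilde t_{F_k})\hat a\vdash X$ for atoms $a,b$ such that performing the substitutions (innermost first) on $a$ and on $b$ yields the same atomic formula. 6. Unit rules $X\vdash Y/\!/\hat\top\hat\wedge X\vdash Y$ and $Y\vdash X/\!/Y\vdash X\check\vee\check\bot$; exchange, weakening, contraction and associativity (in both directions) for $\hat\wedge$ on the left and for $\check\vee$ on the right. 7. Equality: $(t\hat=t)\hat\wedge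 X\vdash Y\,/\,X\vdash Y$; and, for $y\notin F$, $$(\tilde x_1)\cdots(\tilde x_n)\,t\hat=s\vdash(\tilde y_1)\cdots(\tilde y_m)\,(\widetilde{t_y,r_F})X\ \big/\ (\tilde x_1)\cdots(\tilde x_n)\,t\hat=s\vdash(\tilde z_1)\cdots(\tilde z_k)\,(\widetilde{s_y,r_F})X,$$ where $\{x_i\}=\mathsf{FV}(r_F)\setminus\mathsf{FV}(t,s)$, $\{y_i\}=\mathsf{FV}(s)\setminus\mathsf{FV}(t,r_F)$, $\{z_i\}=\mathsf{FV}(t)\setminus\mathsf{FV}(s,r_F)$ and $(s_y,r_F)$ is $r_F$ extended by the term $s$ at $y$. 8. Introduction rules. Left rules replacing the displayed precedent structure by the corresponding formula: $\hat R(\bar t)$ by $R(\bar t)$, $s\hat=t$ by $s=t$, $\hat\top$ by $\top$, $A\hat\wedge B$ by $A\wedge B$, $\langle\hat x\rangle A$ by $\langle x\rangle A$, $(\tilde x)A$ by $(x)A$, $(\tilde t_{F'})A$ by $(t_{F'})A$. Right rules replacing the displayed succedent structure by the corresponding formula: $\check\bot$ by $\bot$, $A\check\vee B$ by $A\vee B$,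 $A\check\to B$ by $A\to B$, $[\check x]A$ by $[x]A$, $(\tilde x)A$ by $(x)A$, $(\tilde t_{F'})A$ by $(t_{F'})A$. Further: $X\vdash A,\ Y\vdash B/X\hat\wedge Y\vdash A\wedge B$; $A\vdash X,\ B\vdash Y/A\vee B\vdash X\check\vee Y$; $X\vdash A,\ B\vdash Y/A\to B\vdash X\check\to Y$; $X\vdash_F A/\langle\hat x\rangle X\vdash_{F\setminus\{x\}}\langle x\rangle A$; $A\vdash_F X/[x]A\vdash_{F\setminus\{x\}}[\check x]X$. 9. Grishin rules: $X\hat>(Y\hat\wedge Z)\vdash W/(X\hat>Y)\hat\wedge Z\vdash W$; $W\vdash X\check\to(Y\check\vee Z)/W\vdash(X\check\to Y)\check\vee Z$. 10. Monotonicity: $X\vdash_{F\setminus\{x\}}Y/\!/(\tilde x)X\vdash_{F\cup\{x\}}(\tilde x)Y$; $X\vdash_{F'}Y/(\tilde t_{F'})X\vdash_F(\tilde t_{F'})Y$ with $\mathsf{FV}(t_{F'})=F$. 11. Distribution, for $\star=x$ or $\star=t_F$: $(\tilde\star)X\circ(\tilde\star)Y\vdash Z/\!/(\tilde\star)(X\circ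 Y)\vdash Z$ for $\circ\in\{\hat\wedge,\hat>,\hat<\}$, and $Z\vdash(\tilde\star)X\circ(\tilde\star)Y/\!/Z\vdash(\tilde\star)(X\circ Y)$ for $\circ\in\{\check\vee,\check\to,\check\leftarrow\}$. 12. Interaction rules: the invertible rules that exchange, in place of the whole precedent of a sequent, $(\tilde x)\langle\hat y\rangle X$ with $\langle\hat y\rangle(\tilde x)X$ and $(\tilde t_F)\langle\hat y\rangle X$ with $\langle\hat z\rangle(\widetilde{z_y,t_F})X$; in place of the whole succedent, $(\tilde x)[\check y]X$ with $[\check y](\tilde x)X$ and $(\tilde t_F)[\check y]X$ with $[\check z](\widetilde{z_y,t_F})X$; and in place of either, $(\tilde x)(\tilde y)X$ with $(\tilde y)(\tilde x)X$, $(\tilde t_F)(\tilde s_{F'})X$ with $(\widetilde{s(t_F/F)}_{F'})X$, and $(\widetilde{s_y,t_F})(\tilde y)X$ with $(\tilde z_1)\cdots(\tilde z_k)(\tilde t_F)X$. Here $x\neq y$; $y\notin F$ in the rules with $(\cdot_y,t_F)$; $z\notin\mathsf{FV}(t_F)\cup F$; $\{z_1,\dots,z_k\}=\mathsf{FV}(s)\setminus\mathsf{FV}(t_F)$.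 **Theorem.** (i) (Cut elimination) Every sequent derivable in $\mathrm{D.FO}$ has a derivation in $\mathrm{D.FO}$ that does not use the cut rule. (ii) (Subformula property) In every cut-free derivation in $\mathrm{D.FO}$, every formula occurring as a substructure in some sequent of the derivation is a subformula of a formula occurring as a substructure in the end-sequent. (The structural atoms $\hat R(\bar t)$ and $s\,\hat=\,t$ are not formulas.) -/

import Mathlib

universe u v

/-!
The proper multi-type display calculus D.FO for classical first-order logic with equality.

The individual variables are the natural numbers, a signature is a `FirstOrder.Language`, and
terms are Mathlib's `L.Term ℕ`. A type is a finite set of variables. Formulas, structures and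
sequents are given by raw syntax together with a typing predicate; every sequent in a derivation
is required to be well-typed.
-/

namespace DFO

/-! ### Substitutions and atoms -/

/-- A family `t_F : F → Trm` of terms indexed by a finite set `F` of variables (`F` is `dom`). -/
structure TSeq (L : FirstOrder.Language.{u, v}) where
  dom : Finset ℕ
  val : dom → L.Term ℕ

namespace TSeq

variable {L : FirstOrder.Language.{u, v}}

/-- The set `FV(t_F)` of variables occurring in some term of the family. -/
def fv (t : TSeq L) : Finset ℕ :=
  Finset.univ.biUnion fun v : t.dom => (t.val v).varFinset

/-- The simultaneous substitution given by `t_F`, as a map on all variables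
(variables outside `F` are left unchanged). -/
def toFun (t : TSeq L) (v : ℕ) : L.Term ℕ :=
  if h : v ∈ t.dom then t.val ⟨v, h⟩ else .var v

/-- The family `(s_y, t_F)` with domain `F ∪ {y}`, which has the term `s` at `y`. -/
def cons (y : ℕ) (s : L.Term ℕ) (t : TSeq L) : TSeq L where
  dom := insert y t.dom
  val v := if h : (v : ℕ) = y then s else t.val ⟨v, Finset.mem_of_mem_insert_of_ne v.2 h⟩

/-- The family `(s(t/x))_{F'}` obtained by applying the substitution `t_F` to every term of
`s_{F'}`. -/
def comp (t s : TSeq L) : TSeq L where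
  dom := s.dom
  val v := (s.val v).subst t.toFun

end TSeq

/-- Atomic formulas `R(t₁, …, tₙ)` and `s = t`. -/
inductive Atom (L : FirstOrder.Language.{u, v}) : Type (max u v)
  | rel {n : ℕ} (R : L.Relations n) (ts : Fin n → L.Term ℕ) : Atom L
  | eq (s t : L.Term ℕ) : Atom L

namespace Atom

variable {L : FirstOrder.Language.{u, v}}

/-- Free variables of an atomic formula. -/
def fv : Atom L → Finset ℕ
  | rel _ ts => Finset.univ.biUnion fun i => (ts i).varFinset
  | eq s t => s.varFinset ∪ t.varFinset

/-- Performing a simultaneous substitution in an atomic formula. -/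
def subst (t : TSeq L) : Atom L → Atom L
  | rel R ts => rel R fun i => (ts i).subst t.toFun
  | eq r s => eq (r.subst t.toFun) (s.subst t.toFun)

/-- The first-order translation of `(t_{F₁}) ⋯ (t_{Fₖ}) a` for an atomic formula `a`: the atomic
formula that results from performing the substitutions, the innermost `(t_{Fₖ})` first. -/
def translate (ts : List (TSeq L)) (a : Atom L) : Atom L := ts.foldr subst a

end Atom

/-! ### Formulas -/

/-- Raw formulas of D.FO (operational language). -/
inductive Fm (L : FirstOrder.Language.{u, v}) : Type (max u v)
  | atom (a : Atom L) : Fm L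
  /-- `⊤_F` -/
  | top (F : Finset ℕ) : Fm L
  /-- `⊥_F` -/
  | bot (F : Finset ℕ) : Fm L
  | and (A B : Fm L) : Fm L
  | or (A B : Fm L) : Fm L
  | imp (A B : Fm L) : Fm L
  /-- `[y] A` (universal quantification) -/
  | all (y : ℕ) (A : Fm L) : Fm L
  /-- `⟨y⟩ A` (existential quantification) -/
  | ex (y : ℕ) (A : Fm L) : Fm L
  /-- `(x) A` (cylindrification) -/
  | cyl (x : ℕ) (A : Fm L) : Fm L
  /-- `(t_F) A` (explicit substitution) -/
  | sub (t : TSeq L) (A : Fm L) : Fm L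

namespace Fm

variable {L : FirstOrder.Language.{u, v}}

/-- `A.HasTy F`: the raw formula `A` is an `F`-formula. -/
def HasTy : Fm L → Finset ℕ → Prop
  | atom a, F => a.fv = F
  | top G, F => G = F
  | bot G, F => G = F
  | and A B, F => A.HasTy F ∧ B.HasTy F
  | or A B, F => A.HasTy F ∧ B.HasTy F
  | imp A B, F => A.HasTy F ∧ B.HasTy F
  | all y A, F => y ∉ F ∧ A.HasTy (insert y F)
  | ex y A, F => y ∉ F ∧ A.HasTy (insert y F)
  | cyl x A, F => x ∈ F ∧ A.HasTy (F.erase x)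
  | sub t A, F => t.fv = F ∧ A.HasTy t.dom

/-- The set of subformulas of a formula (including the formula itself). -/
def subformulas : Fm L → Set (Fm L)
  | atom a => {atom a}
  | top F => {top F}
  | bot F => {bot F}
  | and A B => {and A B} ∪ A.subformulas ∪ B.subformulas
  | or A B => {or A B} ∪ A.subformulas ∪ B.subformulas
  | imp A B => {imp A B} ∪ A.subformulas ∪ B.subformulas
  | all y A => {all y A} ∪ A.subformulas
  | ex y A => {ex y A} ∪ A.subformulas
  | cyl x A => {cyl x A} ∪ A.subformulas
  | sub t A => {sub t A} ∪ A.subformulas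

end Fm

/-! ### Structures and sequents -/

/-- Structures are sorted by the position in which they may occur in a sequent. -/
inductive Pol : Type
  | pre
  | suc

/-- Raw structures in precedent (`Pol.pre`) and succedent (`Pol.suc`) position. Connectives that
are written with a hat occur in precedent position only, those written with a check in succedent
position only, and those written with a tilde in both. -/
inductive Str (L : FirstOrder.Language.{u, v}) : Pol → Type (max u v)
  /-- A formula, taken as a structure. -/
  | fml {p : Pol} (A : Fm L) : Str L p
  /-- `(x̃) X` -/
  | cyl {p : Pol} (x : ℕ) (X : Str L p) : Str L p
  /-- `(t̃_F) X` -/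
  | sub {p : Pol} (t : TSeq L) (X : Str L p) : Str L p
  /-- The structural constant for `⊤_F`. -/
  | top (F : Finset ℕ) : Str L Pol.pre
  /-- The structural counterpart of an atomic formula. -/
  | atom (a : Atom L) : Str L Pol.pre
  /-- Structural conjunction. -/
  | and (X Y : Str L Pol.pre) : Str L Pol.pre
  /-- `X > Y`, the left residual of structural disjunction. -/
  | rexc (X : Str L Pol.suc) (Y : Str L Pol.pre) : Str L Pol.pre
  /-- `X < Y`, the right residual of structural disjunction. -/
  | lexc (X : Str L Pol.pre) (Y : Str L Pol.suc) : Str L Pol.pre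
  /-- `⟨x⟩ X` -/
  | ex (x : ℕ) (X : Str L Pol.pre) : Str L Pol.pre
  /-- `⟨t_F⟩ X`, the left adjoint of substitution. -/
  | dia (t : TSeq L) (X : Str L Pol.pre) : Str L Pol.pre
  /-- The structural constant for `⊥_F`. -/
  | bot (F : Finset ℕ) : Str L Pol.suc
  /-- Structural disjunction. -/
  | or (X Y : Str L Pol.suc) : Str L Pol.suc
  /-- `X → Y` -/
  | imp (X : Str L Pol.pre) (Y : Str L Pol.suc) : Str L Pol.suc
  /-- `X ← Y` -/
  | limp (X : Str L Pol.suc) (Y : Str L Pol.pre) : Str L Pol.suc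
  /-- `[x] X` -/
  | all (x : ℕ) (X : Str L Pol.suc) : Str L Pol.suc
  /-- `[t_F] X`, the right adjoint of substitution. -/
  | box (t : TSeq L) (X : Str L Pol.suc) : Str L Pol.suc

namespace Str

variable {L : FirstOrder.Language.{u, v}}

/-- `X.HasTy F`: the raw structure `X` has type `F`. -/
def HasTy : {p : Pol} → Str L p → Finset ℕ → Prop
  | _, fml A, F => A.HasTy F
  | _, cyl x X, F => x ∈ F ∧ X.HasTy (F.erase x)
  | _, sub t X, F => t.fv = F ∧ X.HasTy t.dom
  | _, top G, F => G = F
  | _, atom a, F => a.fv = F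
  | _, and X Y, F => X.HasTy F ∧ Y.HasTy F
  | _, rexc X Y, F => X.HasTy F ∧ Y.HasTy F
  | _, lexc X Y, F => X.HasTy F ∧ Y.HasTy F
  | _, ex x X, F => x ∉ F ∧ X.HasTy (insert x F)
  | _, dia t X, F => t.dom = F ∧ X.HasTy t.fv
  | _, bot G, F => G = F
  | _, or X Y, F => X.HasTy F ∧ Y.HasTy F
  | _, imp X Y, F => X.HasTy F ∧ Y.HasTy F
  | _, limp X Y, F => X.HasTy F ∧ Y.HasTy F
  | _, all x X, F => x ∉ F ∧ X.HasTy (insert x F)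
  | _, box t X, F => t.dom = F ∧ X.HasTy t.fv

/-- The set of formulas occurring, as substructures, in a structure. -/
def formulas : {p : Pol} → Str L p → Set (Fm L)
  | _, fml A => {A}
  | _, cyl _ X => X.formulas
  | _, sub _ X => X.formulas
  | _, top _ => ∅
  | _, atom _ => ∅
  | _, and X Y => X.formulas ∪ Y.formulas
  | _, rexc X Y => X.formulas ∪ Y.formulas
  | _, lexc X Y => X.formulas ∪ Y.formulas
  | _, ex _ X => X.formulas
  | _, dia _ X => X.formulas
  | _, bot _ => ∅
  | _, or X Y => X.formulas ∪ Y.formulas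
  | _, imp X Y => X.formulas ∪ Y.formulas
  | _, limp X Y => X.formulas ∪ Y.formulas
  | _, all _ X => X.formulas
  | _, box _ X => X.formulas

/-- `(x̃₁) ⋯ (x̃ₙ) X` -/
def cyls {p : Pol} (xs : List ℕ) (X : Str L p) : Str L p := xs.foldr cyl X

/-- `(t̃_{F₁}) ⋯ (t̃_{Fₖ}) X` -/
def subs {p : Pol} (ts : List (TSeq L)) (X : Str L p) : Str L p := ts.foldr sub X

end Str

/-- Raw sequents `X ⊢_F Y`. -/
structure Sequent (L : FirstOrder.Language.{u, v}) where
  ty : Finset ℕ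
  ant : Str L Pol.pre
  con : Str L Pol.suc

namespace Sequent

variable {L : FirstOrder.Language.{u, v}}

/-- Both sides of `X ⊢_F Y` are structures of type `F`. -/
def WellTyped (S : Sequent L) : Prop := S.ant.HasTy S.ty ∧ S.con.HasTy S.ty

/-- The formulas occurring in a sequent. -/
def formulas (S : Sequent L) : Set (Fm L) := S.ant.formulas ∪ S.con.formulas

end Sequent

/-! ### Rules -/

variable {L : FirstOrder.Language.{u, v}}

/-- Rules without premises. -/
inductive Ax : Sequent L → Prop
  | id (F : Finset ℕ) (a : Atom L) : Ax ⟨F, .atom a, .fml (.atom a)⟩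
  | botL (F : Finset ℕ) : Ax ⟨F, .fml (.bot F), .bot F⟩
  | topR (F : Finset ℕ) : Ax ⟨F, .top F, .fml (.top F)⟩

/-- Invertible one-premise rules (displayed with a double line); the first argument is the upper
sequent, the second the lower one. -/
inductive DoubleLine : Sequent L → Sequent L → Prop
  -- Display postulates for the homogeneous connectives
  | andImp (F : Finset ℕ) (X Y Z) : DoubleLine ⟨F, .and X Y, Z⟩ ⟨F, Y, .imp X Z⟩
  | andLimp (F : Finset ℕ) (X Y Z) : DoubleLine ⟨F, .and X Y, Z⟩ ⟨F, X, .limp Z Y⟩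
  | orRexc (F : Finset ℕ) (X Y Z) : DoubleLine ⟨F, Z, .or X Y⟩ ⟨F, .rexc X Z, Y⟩
  | orLexc (F : Finset ℕ) (X Y Z) : DoubleLine ⟨F, Z, .or X Y⟩ ⟨F, .lexc Z Y, X⟩
  -- Display postulates for quantifiers
  | cylEx (F : Finset ℕ) (x : ℕ) (X Y) :
      DoubleLine ⟨insert x F, X, .cyl x Y⟩ ⟨F.erase x, .ex x X, Y⟩
  | cylAll (F : Finset ℕ) (x : ℕ) (X Y) :
      DoubleLine ⟨insert x F, .cyl x Y, X⟩ ⟨F.erase x, Y, .all x X⟩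
  -- Display postulates for substitutions
  | subDia (t : TSeq L) (X Y) : DoubleLine ⟨t.fv, Y, .sub t X⟩ ⟨t.dom, .dia t Y, X⟩
  | subBox (t : TSeq L) (X Y) : DoubleLine ⟨t.fv, .sub t X, Y⟩ ⟨t.dom, X, .box t Y⟩
  -- Necessitation for quantifiers
  | necCylTop (F : Finset ℕ) (x : ℕ) (X) :
      DoubleLine ⟨insert x F, .top (insert x F), X⟩ ⟨insert x F, .cyl x (.top (F.erase x)), X⟩
  | necCylBot (F : Finset ℕ) (x : ℕ) (X) :
      DoubleLine ⟨insert x F, X, .bot (insert x F)⟩ ⟨insert x F, X, .cyl x (.bot (F.erase x))⟩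
  -- Necessitation for substitution
  | necSubTop (t : TSeq L) (X) : DoubleLine ⟨t.fv, .top t.fv, X⟩ ⟨t.fv, .sub t (.top t.dom), X⟩
  | necSubBot (t : TSeq L) (X) : DoubleLine ⟨t.fv, X, .bot t.fv⟩ ⟨t.fv, X, .sub t (.bot t.dom)⟩
  -- Structural rules for conjunction and disjunction
  | topL (F : Finset ℕ) (X Y) : DoubleLine ⟨F, X, Y⟩ ⟨F, .and (.top F) X, Y⟩
  | botR (F : Finset ℕ) (X Y) : DoubleLine ⟨F, Y, X⟩ ⟨F, Y, .or X (.bot F)⟩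
  | assocL (F : Finset ℕ) (X Y Z W) :
      DoubleLine ⟨F, .and X (.and Y Z), W⟩ ⟨F, .and (.and X Y) Z, W⟩
  | assocR (F : Finset ℕ) (X Y Z W) :
      DoubleLine ⟨F, W, .or (.or Z Y) X⟩ ⟨F, W, .or Z (.or Y X)⟩
  -- Monotonicity and order embedding for cylindrification
  | monoCyl (F : Finset ℕ) (x : ℕ) (X Y) :
      DoubleLine ⟨F.erase x, X, Y⟩ ⟨insert x F, .cyl x X, .cyl x Y⟩
  -- Interaction between cylindrification and the homogeneous connectives
  | cylRexc (F : Finset ℕ) (x : ℕ) (X Y Z) :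
      DoubleLine ⟨F, .rexc (.cyl x X) (.cyl x Y), Z⟩ ⟨F, .cyl x (.rexc X Y), Z⟩
  | cylImp (F : Finset ℕ) (x : ℕ) (X Y Z) :
      DoubleLine ⟨F, Z, .imp (.cyl x X) (.cyl x Y)⟩ ⟨F, Z, .cyl x (.imp X Y)⟩
  | cylLexc (F : Finset ℕ) (x : ℕ) (X Y Z) :
      DoubleLine ⟨F, .lexc (.cyl x X) (.cyl x Y), Z⟩ ⟨F, .cyl x (.lexc X Y), Z⟩
  | cylLimp (F : Finset ℕ) (x : ℕ) (X Y Z) :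
      DoubleLine ⟨F, Z, .limp (.cyl x X) (.cyl x Y)⟩ ⟨F, Z, .cyl x (.limp X Y)⟩
  | cylAnd (F : Finset ℕ) (x : ℕ) (X Y Z) :
      DoubleLine ⟨F, .and (.cyl x X) (.cyl x Y), Z⟩ ⟨F, .cyl x (.and X Y), Z⟩
  | cylOr (F : Finset ℕ) (x : ℕ) (X Y Z) :
      DoubleLine ⟨F, Z, .or (.cyl x X) (.cyl x Y)⟩ ⟨F, Z, .cyl x (.or X Y)⟩
  -- Interaction between substitution and the homogeneous connectives
  | subAnd (F : Finset ℕ) (t : TSeq L) (X Y Z) :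
      DoubleLine ⟨F, .and (.sub t X) (.sub t Y), Z⟩ ⟨F, .sub t (.and X Y), Z⟩
  | subOr (F : Finset ℕ) (t : TSeq L) (X Y Z) :
      DoubleLine ⟨F, Z, .or (.sub t X) (.sub t Y)⟩ ⟨F, Z, .sub t (.or X Y)⟩
  | subRexc (F : Finset ℕ) (t : TSeq L) (X Y Z) :
      DoubleLine ⟨F, .rexc (.sub t X) (.sub t Y), Z⟩ ⟨F, .sub t (.rexc X Y), Z⟩
  | subImp (F : Finset ℕ) (t : TSeq L) (X Y Z) :
      DoubleLine ⟨F, Z, .imp (.sub t X) (.sub t Y)⟩ ⟨F, Z, .sub t (.imp X Y)⟩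
  | subLexc (F : Finset ℕ) (t : TSeq L) (X Y Z) :
      DoubleLine ⟨F, .lexc (.sub t X) (.sub t Y), Z⟩ ⟨F, .sub t (.lexc X Y), Z⟩
  | subLimp (F : Finset ℕ) (t : TSeq L) (X Y Z) :
      DoubleLine ⟨F, Z, .limp (.sub t X) (.sub t Y)⟩ ⟨F, Z, .sub t (.limp X Y)⟩
  -- Interaction between heterogeneous connectives
  | cqL (F : Finset ℕ) (x y : ℕ) (X Y) (hxy : x ≠ y) :
      DoubleLine ⟨F, .cyl x (.ex y X), Y⟩ ⟨F, .ex y (.cyl x X), Y⟩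
  | cqR (F : Finset ℕ) (x y : ℕ) (X Y) (hxy : x ≠ y) :
      DoubleLine ⟨F, Y, .cyl x (.all y X)⟩ ⟨F, Y, .all y (.cyl x X)⟩
  | sqL (F : Finset ℕ) (t : TSeq L) (y z : ℕ) (X Y) (hy : y ∉ t.dom) (hz : z ∉ t.fv ∪ t.dom) :
      DoubleLine ⟨F, .sub t (.ex y X), Y⟩ ⟨F, .ex z (.sub (t.cons y (.var z)) X), Y⟩
  | sqR (F : Finset ℕ) (t : TSeq L) (y z : ℕ) (X Y) (hy : y ∉ t.dom) (hz : z ∉ t.fv ∪ t.dom) :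
      DoubleLine ⟨F, Y, .sub t (.all y X)⟩ ⟨F, Y, .all z (.sub (t.cons y (.var z)) X)⟩
  | ccL (F : Finset ℕ) (x y : ℕ) (X Y) (hxy : x ≠ y) :
      DoubleLine ⟨F, .cyl x (.cyl y X), Y⟩ ⟨F, .cyl y (.cyl x X), Y⟩
  | ccR (F : Finset ℕ) (x y : ℕ) (X Y) (hxy : x ≠ y) :
      DoubleLine ⟨F, Y, .cyl x (.cyl y X)⟩ ⟨F, Y, .cyl y (.cyl x X)⟩
  | ssL (F : Finset ℕ) (t s : TSeq L) (X Y) :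
      DoubleLine ⟨F, .sub t (.sub s X), Y⟩ ⟨F, .sub (t.comp s) X, Y⟩
  | ssR (F : Finset ℕ) (t s : TSeq L) (X Y) :
      DoubleLine ⟨F, Y, .sub t (.sub s X)⟩ ⟨F, Y, .sub (t.comp s) X⟩
  | scL (F : Finset ℕ) (t : TSeq L) (y : ℕ) (s : L.Term ℕ) (zs : List ℕ) (X Y)
      (hy : y ∉ t.dom) (hzs : zs.toFinset = s.varFinset \ t.fv) :
      DoubleLine ⟨F, .sub (t.cons y s) (.cyl y X), Y⟩ ⟨F, .cyls zs (.sub t X), Y⟩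
  | scR (F : Finset ℕ) (t : TSeq L) (y : ℕ) (s : L.Term ℕ) (zs : List ℕ) (X Y)
      (hy : y ∉ t.dom) (hzs : zs.toFinset = s.varFinset \ t.fv) :
      DoubleLine ⟨F, Y, .sub (t.cons y s) (.cyl y X)⟩ ⟨F, Y, .cyls zs (.sub t X)⟩

/-- One-premise rules that are used downwards only: premise, conclusion. -/
inductive SingleLine : Sequent L → Sequent L → Prop
  -- Additional adjunction-related rules
  | cadj (F : Finset ℕ) (x : ℕ) (X Y) : SingleLine ⟨F, .cyl x (.ex x X), Y⟩ ⟨F, X, Y⟩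
  | sadj (F : Finset ℕ) (t : TSeq L) (X Y) : SingleLine ⟨F, .sub t (.dia t X), Y⟩ ⟨F, X, Y⟩
  -- Structural rules for atomic formulas
  | atomStr (F : Finset ℕ) (ss ts : List (TSeq L)) (a b : Atom L) (X)
      (h : Atom.translate ts a = Atom.translate ss b) :
      SingleLine ⟨F, .subs ss (.atom b), X⟩ ⟨F, .subs ts (.atom a), X⟩
  -- Exchange, weakening, contraction
  | exchL (F : Finset ℕ) (X Y Z) : SingleLine ⟨F, .and Y X, Z⟩ ⟨F, .and X Y, Z⟩
  | exchR (F : Finset ℕ) (X Y Z) : SingleLine ⟨F, Z, .or X Y⟩ ⟨F, Z, .or Y X⟩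
  | weakL (F : Finset ℕ) (X Y Z) : SingleLine ⟨F, Y, Z⟩ ⟨F, .and X Y, Z⟩
  | weakR (F : Finset ℕ) (X Y Z) : SingleLine ⟨F, Z, Y⟩ ⟨F, Z, .or Y X⟩
  | contrL (F : Finset ℕ) (X Y) : SingleLine ⟨F, .and X X, Y⟩ ⟨F, X, Y⟩
  | contrR (F : Finset ℕ) (X Y) : SingleLine ⟨F, Y, .or X X⟩ ⟨F, Y, X⟩
  -- Structural rules for equality
  | eqRefl (F : Finset ℕ) (t : L.Term ℕ) (X Y) :
      SingleLine ⟨F, .and (.atom (.eq t t)) X, Y⟩ ⟨F, X, Y⟩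
  | eqRepl (F : Finset ℕ) (t s : L.Term ℕ) (r : TSeq L) (y : ℕ) (xs ys zs : List ℕ) (X)
      (hy : y ∉ r.dom)
      (hxs : xs.toFinset = r.fv \ (t.varFinset ∪ s.varFinset))
      (hys : ys.toFinset = s.varFinset \ (t.varFinset ∪ r.fv))
      (hzs : zs.toFinset = t.varFinset \ (s.varFinset ∪ r.fv)) :
      SingleLine ⟨F, .cyls xs (.atom (.eq t s)), .cyls ys (.sub (r.cons y t) X)⟩
        ⟨F, .cyls xs (.atom (.eq t s)), .cyls zs (.sub (r.cons y s) X)⟩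
  -- Introduction rules for atomic formulas
  | atomL (F : Finset ℕ) (a : Atom L) (X) : SingleLine ⟨F, .atom a, X⟩ ⟨F, .fml (.atom a), X⟩
  -- One-premise introduction rules for the propositional connectives
  | botR (F : Finset ℕ) (X) : SingleLine ⟨F, X, .bot F⟩ ⟨F, X, .fml (.bot F)⟩
  | topL (F : Finset ℕ) (X) : SingleLine ⟨F, .top F, X⟩ ⟨F, .fml (.top F), X⟩
  | andL (F : Finset ℕ) (A B : Fm L) (X) :
      SingleLine ⟨F, .and (.fml A) (.fml B), X⟩ ⟨F, .fml (.and A B), X⟩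
  | orR (F : Finset ℕ) (A B : Fm L) (X) :
      SingleLine ⟨F, X, .or (.fml A) (.fml B)⟩ ⟨F, X, .fml (.or A B)⟩
  | impR (F : Finset ℕ) (A B : Fm L) (X) :
      SingleLine ⟨F, X, .imp (.fml A) (.fml B)⟩ ⟨F, X, .fml (.imp A B)⟩
  -- Grishin rules
  | grishinL (F : Finset ℕ) (X Y Z W) :
      SingleLine ⟨F, .rexc X (.and Y Z), W⟩ ⟨F, .and (.rexc X Y) Z, W⟩
  | grishinR (F : Finset ℕ) (X Y Z W) :
      SingleLine ⟨F, W, .imp X (.or Y Z)⟩ ⟨F, W, .or (.imp X Y) Z⟩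
  -- Introduction rules for the heterogeneous connectives
  | exL (F : Finset ℕ) (x : ℕ) (A : Fm L) (X) :
      SingleLine ⟨F, .ex x (.fml A), X⟩ ⟨F, .fml (.ex x A), X⟩
  | exR (F : Finset ℕ) (x : ℕ) (A : Fm L) (X) :
      SingleLine ⟨F, X, .fml A⟩ ⟨F.erase x, .ex x X, .fml (.ex x A)⟩
  | allL (F : Finset ℕ) (x : ℕ) (A : Fm L) (X) :
      SingleLine ⟨F, .fml A, X⟩ ⟨F.erase x, .fml (.all x A), .all x X⟩
  | allR (F : Finset ℕ) (x : ℕ) (A : Fm L) (X) :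
      SingleLine ⟨F, X, .all x (.fml A)⟩ ⟨F, X, .fml (.all x A)⟩
  | cylL (F : Finset ℕ) (x : ℕ) (A : Fm L) (X) :
      SingleLine ⟨F, .cyl x (.fml A), X⟩ ⟨F, .fml (.cyl x A), X⟩
  | cylR (F : Finset ℕ) (x : ℕ) (A : Fm L) (X) :
      SingleLine ⟨F, X, .cyl x (.fml A)⟩ ⟨F, X, .fml (.cyl x A)⟩
  | subL (F : Finset ℕ) (t : TSeq L) (A : Fm L) (X) :
      SingleLine ⟨F, .sub t (.fml A), X⟩ ⟨F, .fml (.sub t A), X⟩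
  | subR (F : Finset ℕ) (t : TSeq L) (A : Fm L) (X) :
      SingleLine ⟨F, X, .sub t (.fml A)⟩ ⟨F, X, .fml (.sub t A)⟩
  -- Monotonicity for substitution
  | monoSub (t : TSeq L) (X Y) : SingleLine ⟨t.dom, X, Y⟩ ⟨t.fv, .sub t X, .sub t Y⟩

/-- One-premise rules: premise, conclusion. -/
def Unary (p c : Sequent L) : Prop := SingleLine p c ∨ DoubleLine p c ∨ DoubleLine c p

/-- Two-premise rules other than cut: left premise, right premise, conclusion. -/
inductive Binary : Sequent L → Sequent L → Sequent L → Prop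
  | andR (F X Y A B) :
      Binary ⟨F, X, .fml A⟩ ⟨F, Y, .fml B⟩ ⟨F, .and X Y, .fml (.and A B)⟩
  | orL (F X Y A B) :
      Binary ⟨F, .fml A, X⟩ ⟨F, .fml B, Y⟩ ⟨F, .fml (.or A B), .or X Y⟩
  | impL (F X Y A B) :
      Binary ⟨F, X, .fml A⟩ ⟨F, .fml B, Y⟩ ⟨F, .fml (.imp A B), .imp X Y⟩

/-! ### Derivations -/

/-- Derivations in D.FO of a given end-sequent. All sequents in a derivation are well-typed
(the conclusion of a cut is well-typed because its premises are). -/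
inductive Derivation : Sequent L → Type (max u v)
  | ax {c : Sequent L} (h : Ax c) (wt : c.WellTyped) : Derivation c
  | unary {p c : Sequent L} (h : Unary p c) (wt : c.WellTyped) (d : Derivation p) : Derivation c
  | binary {p q c : Sequent L} (h : Binary p q c) (wt : c.WellTyped)
      (d : Derivation p) (e : Derivation q) : Derivation c
  | cut {F : Finset ℕ} {X : Str L Pol.pre} {Y : Str L Pol.suc} (A : Fm L)
      (d : Derivation ⟨F, X, .fml A⟩) (e : Derivation ⟨F, .fml A, Y⟩) : Derivation ⟨F, X, Y⟩

namespace Derivation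

/-- The derivation does not use the cut rule. -/
def CutFree : {S : Sequent L} → Derivation S → Prop
  | _, ax _ _ => True
  | _, unary _ _ d => d.CutFree
  | _, binary _ _ d e => d.CutFree ∧ e.CutFree
  | _, cut _ _ _ => False

/-- The set of sequents occurring in a derivation (including the end-sequent). -/
def sequents : {S : Sequent L} → Derivation S → Set (Sequent L)
  | S, ax _ _ => {S}
  | S, unary _ _ d => {S} ∪ d.sequents
  | S, binary _ _ d e => {S} ∪ d.sequents ∪ e.sequents
  | S, cut _ d e => {S} ∪ d.sequents ∪ e.sequents

/-- Every formula occurring in the derivation is a subformula of a formula occurring in its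
end-sequent. -/
def HasSubformulaProperty {S : Sequent L} (d : Derivation S) : Prop :=
  ∀ T ∈ d.sequents, ∀ A ∈ T.formulas, ∃ B ∈ S.formulas, A ∈ B.subformulas

end Derivation

end DFO

namespace DFO
variable {L : FirstOrder.Language.{u, v}}

/-! ### Uniqueness of types -/

/-! Cut elimination follows Belnap's method for display calculi, by induction on the cut formula
`A`. Apart from the formulas they introduce, rules are schematic in their structures, so a formula
passed down unchanged may be replaced by a structure of the same polarity and type in premise and
conclusion alike. Types are unique, so well-typedness survives the replacement.

Given cut-free proofs of `X ⊢ A` and `A ⊢ Y`, trace the succedent `A` upwards through the first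
proof and put `Y` in its place. This fails only where `A` has just been introduced, say in `X' ⊢ A`;
there `X' ⊢ Y` is needed. Tracing the precedent `A` through the second proof and putting `X'` in its
place leaves only the case where both occurrences of `A` are principal
(`CutAdmissible.of_principal`, resting on `CutFreeProvable.repl`).

A principal cut reduces to cuts on immediate subformulas by means of the display postulates
(`cutAdmissible`). For `(x)A` and `(t)A` the reduction ends in a structure of the form `(x̃)⟨x⟩X` or
`(t̃)⟨t⟩X`, which the adjunction rules turn back into `X`. Structural atoms are not formulas, so the
atomic and equality rules create no principal case.

The subformula property is a check of each rule: formulas in premises of rules other than cut are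
subformulas of formulas in the conclusion. -/

theorem Fm.HasTy.unique {A : Fm L} {F G : Finset ℕ} (hF : A.HasTy F) (hG : A.HasTy G) : F = G := by
  induction A generalizing F G with
  | atom a => exact hF.symm.trans hG
  | top H => exact hF.symm.trans hG
  | bot H => exact hF.symm.trans hG
  | and A B ihA _ => exact ihA hF.1 hG.1
  | or A B ihA _ => exact ihA hF.1 hG.1
  | imp A B ihA _ => exact ihA hF.1 hG.1
  | all y A ih =>
    -- Freshness of `y` makes the type recoverable from that of the body by erasing `y`.
    rw [← Finset.erase_insert hF.1, ih hF.2 hG.2, Finset.erase_insert hG.1]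
  | ex y A ih =>
    rw [← Finset.erase_insert hF.1, ih hF.2 hG.2, Finset.erase_insert hG.1]
  | cyl x A ih =>
    rw [← Finset.insert_erase hF.1, ih hF.2 hG.2, Finset.insert_erase hG.1]
  | sub t A _ => exact hF.1.symm.trans hG.1

theorem Str.HasTy.unique {p : Pol} {X : Str L p} {F G : Finset ℕ} (hF : X.HasTy F)
    (hG : X.HasTy G) : F = G := by
  induction X generalizing F G with
  | fml A => exact Fm.HasTy.unique hF hG
  | top H | bot H | atom a => exact Eq.trans (Eq.symm hF) hG
  | cyl x X ih => rw [← Finset.insert_erase hF.1, ih hF.2 hG.2, Finset.insert_erase hG.1]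
  | sub t X | dia t X | box t X => exact hF.1.symm.trans hG.1
  | and X Y ih _ | rexc X Y ih _ | lexc X Y ih _ | or X Y ih _ | imp X Y ih _ | limp X Y ih _ =>
    exact ih hF.1 hG.1
  | ex x X ih | all x X ih =>
    rw [← Finset.erase_insert hF.1, ih hF.2 hG.2, Finset.erase_insert hG.1]

/-! ### Cut-free provability -/

/-- Derivability without the cut rule. -/
inductive CutFreeProvable : Sequent L → Prop
  | ax {c : Sequent L} (h : Ax c) (wt : c.WellTyped) : CutFreeProvable c
  | unary {p c : Sequent L} (h : Unary p c) (wt : c.WellTyped) (d : CutFreeProvable p) :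
      CutFreeProvable c
  | binary {p q c : Sequent L} (h : Binary p q c) (wt : c.WellTyped)
      (d : CutFreeProvable p) (e : CutFreeProvable q) : CutFreeProvable c

namespace CutFreeProvable

theorem wellTyped {S : Sequent L} (h : CutFreeProvable S) : S.WellTyped := by
  cases h <;> assumption

/-- Returns from the proposition-valued predicate, on which the inductions are run, to actual
derivations. -/
theorem exists_derivation {S : Sequent L} (h : CutFreeProvable S) :
    ∃ d : Derivation S, d.CutFree := by
  induction h with
  | ax h wt => exact ⟨.ax h wt, trivial⟩
  | unary h wt _ ih =>
    obtain ⟨d, hd⟩ := ih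
    exact ⟨.unary h wt d, hd⟩
  | binary h wt _ _ ihd ihe =>
    obtain ⟨d, hd⟩ := ihd
    obtain ⟨e, he⟩ := ihe
    exact ⟨.binary h wt d e, hd, he⟩

theorem single {p c : Sequent L} (d : CutFreeProvable p) (h : SingleLine p c)
    (wt : c.WellTyped) : CutFreeProvable c :=
  .unary (.inl h) wt d

theorem down {p c : Sequent L} (d : CutFreeProvable p) (h : DoubleLine p c)
    (wt : c.WellTyped) : CutFreeProvable c :=
  .unary (.inr (.inl h)) wt d

theorem up {p c : Sequent L} (d : CutFreeProvable p) (h : DoubleLine c p)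
    (wt : c.WellTyped) : CutFreeProvable c :=
  .unary (.inr (.inr h)) wt d

end CutFreeProvable

/-! ### Replacing parametric occurrences of a formula -/

/-- `X.Repl A P X'`: the structure `X'` results from `X` by replacing some occurrences of the
formula `A`, each by a structure of the same polarity that satisfies `P`. -/
def Str.Repl (A : Fm L) (P : (p : Pol) → Str L p → Prop) :
    {p : Pol} → Str L p → Str L p → Prop
  | p, .fml B, Z => Z = .fml B ∨ B = A ∧ P p Z
  | _, .cyl x X, Z => ∃ X', X.Repl A P X' ∧ Z = .cyl x X'
  | _, .sub t X, Z => ∃ X', X.Repl A P X' ∧ Z = .sub t X'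
  | _, .top G, Z => Z = .top G
  | _, .atom a, Z => Z = .atom a
  | _, .and X Y, Z => ∃ X' Y', X.Repl A P X' ∧ Y.Repl A P Y' ∧ Z = .and X' Y'
  | _, .rexc X Y, Z => ∃ X' Y', X.Repl A P X' ∧ Y.Repl A P Y' ∧ Z = .rexc X' Y'
  | _, .lexc X Y, Z => ∃ X' Y', X.Repl A P X' ∧ Y.Repl A P Y' ∧ Z = .lexc X' Y'
  | _, .ex x X, Z => ∃ X', X.Repl A P X' ∧ Z = .ex x X'
  | _, .dia t X, Z => ∃ X', X.Repl A P X' ∧ Z = .dia t X'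
  | _, .bot G, Z => Z = .bot G
  | _, .or X Y, Z => ∃ X' Y', X.Repl A P X' ∧ Y.Repl A P Y' ∧ Z = .or X' Y'
  | _, .imp X Y, Z => ∃ X' Y', X.Repl A P X' ∧ Y.Repl A P Y' ∧ Z = .imp X' Y'
  | _, .limp X Y, Z => ∃ X' Y', X.Repl A P X' ∧ Y.Repl A P Y' ∧ Z = .limp X' Y'
  | _, .all x X, Z => ∃ X', X.Repl A P X' ∧ Z = .all x X'
  | _, .box t X, Z => ∃ X', X.Repl A P X' ∧ Z = .box t X'

namespace Str

variable {A : Fm L} {P : (p : Pol) → Str L p → Prop}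

theorem Repl.refl {p : Pol} (X : Str L p) : X.Repl A P X := by
  induction X <;> simp_all [Repl]

/-- Iterated cylindrification is a fold rather than a constructor, so the clauses of `Str.Repl` do
not unfold it; needed for the rules `scL`, `scR` and `eqRepl`. -/
theorem repl_cyls {p : Pol} {xs : List ℕ} {X Z : Str L p} :
    (cyls xs X).Repl A P Z ↔ ∃ X', X.Repl A P X' ∧ Z = cyls xs X' := by
  induction xs generalizing Z with
  | nil => simp [cyls]
  | cons x xs ih =>
    change (∃ X', (cyls xs X).Repl A P X' ∧ Z = .cyl x X') ↔
      ∃ X', X.Repl A P X' ∧ Z = .cyl x (cyls xs X')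
    constructor
    · rintro ⟨X', h, rfl⟩
      obtain ⟨X'', h', rfl⟩ := ih.1 h
      exact ⟨X'', h', rfl⟩
    · rintro ⟨X', h, rfl⟩
      exact ⟨_, ih.2 ⟨X', h, rfl⟩, rfl⟩

/-- No formula occurs in such a structure, so the rule `atomStr` is untouched by replacement. -/
theorem repl_subs_atom {ts : List (TSeq L)} {a : Atom L} {Z : Str L .pre} :
    (subs ts (.atom a)).Repl A P Z ↔ Z = subs ts (.atom a) := by
  induction ts generalizing Z with
  | nil => simp [subs, Repl]
  | cons t ts ih =>
    change (∃ X', (subs ts (.atom a)).Repl A P X' ∧ Z = .sub t X') ↔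
      Z = .sub t (subs ts (.atom a))
    simp [ih]

/-- By uniqueness of types, every occurrence of `A` in a typed structure sits at type `H`, the type
of all the replacing structures. -/
theorem Repl.hasTy {H : Finset ℕ} (hA : A.HasTy H) (hP : ∀ p U, P p U → U.HasTy H)
    {p : Pol} {X Z : Str L p} (h : X.Repl A P Z) {F : Finset ℕ} (hX : X.HasTy F) : Z.HasTy F := by
  induction X generalizing F with
  | fml B =>
    rcases h with rfl | ⟨rfl, h⟩
    · exact hX
    · exact Fm.HasTy.unique hA hX ▸ hP _ _ h
  | top G | bot G | atom a => exact (show Z = _ from h) ▸ hX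
  | cyl _ _ ih | sub _ _ ih | ex _ _ ih | dia _ _ ih | all _ _ ih | box _ _ ih =>
    obtain ⟨X', h, rfl⟩ := h
    exact ⟨hX.1, ih h hX.2⟩
  | and _ _ ihX ihY | or _ _ ihX ihY | rexc _ _ ihX ihY | lexc _ _ ihX ihY | imp _ _ ihX ihY
  | limp _ _ ihX ihY =>
    obtain ⟨X', Y', h, h', rfl⟩ := h
    exact ⟨ihX h hX.1, ihY h' hX.2⟩

end Str

/-- Replacement of occurrences of a formula on both sides of a sequent. -/
def Sequent.Repl (A : Fm L) (P : (p : Pol) → Str L p → Prop) (S T : Sequent L) : Prop :=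
  T.ty = S.ty ∧ S.ant.Repl A P T.ant ∧ S.con.Repl A P T.con

/-! ### The rules are closed under replacement -/

section

variable {A : Fm L} {P : (p : Pol) → Str L p → Prop}

/-- No invertible rule mentions a formula, so replaced occurrences can only lie inside the structure
variables. Instantiating these with their replaced versions gives the same rule again. -/
theorem DoubleLine.exists_repl_down {p c c' : Sequent L} (h : DoubleLine p c)
    (hc : c.Repl A P c') : ∃ p', p.Repl A P p' ∧ DoubleLine p' c' := by
  obtain ⟨F', X', Y'⟩ := c'
  cases h <;> obtain ⟨hF, hX, hY⟩ := hc <;>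
    simp only [Str.Repl, Str.repl_cyls] at hF hX hY <;> subst hF <;> (try casesm* _ ∧ _, ∃ _, _) <;>
    subst_vars
  case andImp => exact ⟨_, by simp [Sequent.Repl, Str.Repl, *], .andImp _ _ _ _⟩
  case andLimp => exact ⟨_, by simp [Sequent.Repl, Str.Repl, *], .andLimp _ _ _ _⟩
  case orRexc => exact ⟨_, by simp [Sequent.Repl, Str.Repl, *], .orRexc _ _ _ _⟩
  case orLexc => exact ⟨_, by simp [Sequent.Repl, Str.Repl, *], .orLexc _ _ _ _⟩
  case cylEx => exact ⟨_, by simp [Sequent.Repl, Str.Repl, *], .cylEx _ _ _ _⟩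
  case cylAll => exact ⟨_, by simp [Sequent.Repl, Str.Repl, *], .cylAll _ _ _ _⟩
  case subDia => exact ⟨_, by simp [Sequent.Repl, Str.Repl, *], .subDia _ _ _⟩
  case subBox => exact ⟨_, by simp [Sequent.Repl, Str.Repl, *], .subBox _ _ _⟩
  case necCylTop => exact ⟨_, by simp [Sequent.Repl, Str.Repl, *], .necCylTop _ _ _⟩
  case necCylBot => exact ⟨_, by simp [Sequent.Repl, Str.Repl, *], .necCylBot _ _ _⟩
  case necSubTop => exact ⟨_, by simp [Sequent.Repl, Str.Repl, *], .necSubTop _ _⟩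
  case necSubBot => exact ⟨_, by simp [Sequent.Repl, Str.Repl, *], .necSubBot _ _⟩
  case topL => exact ⟨_, by simp [Sequent.Repl, *], .topL _ _ _⟩
  case botR => exact ⟨_, by simp [Sequent.Repl, *], .botR _ _ _⟩
  case assocL => exact ⟨_, by simp [Sequent.Repl, Str.Repl, *], .assocL _ _ _ _ _⟩
  case assocR => exact ⟨_, by simp [Sequent.Repl, Str.Repl, *], .assocR _ _ _ _ _⟩
  case monoCyl => exact ⟨_, by simp [Sequent.Repl, *], .monoCyl _ _ _ _⟩
  case cylRexc => exact ⟨_, by simp [Sequent.Repl, Str.Repl, *], .cylRexc _ _ _ _ _⟩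
  case cylImp => exact ⟨_, by simp [Sequent.Repl, Str.Repl, *], .cylImp _ _ _ _ _⟩
  case cylLexc => exact ⟨_, by simp [Sequent.Repl, Str.Repl, *], .cylLexc _ _ _ _ _⟩
  case cylLimp => exact ⟨_, by simp [Sequent.Repl, Str.Repl, *], .cylLimp _ _ _ _ _⟩
  case cylAnd => exact ⟨_, by simp [Sequent.Repl, Str.Repl, *], .cylAnd _ _ _ _ _⟩
  case cylOr => exact ⟨_, by simp [Sequent.Repl, Str.Repl, *], .cylOr _ _ _ _ _⟩
  case subAnd => exact ⟨_, by simp [Sequent.Repl, Str.Repl, *], .subAnd _ _ _ _ _⟩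
  case subOr => exact ⟨_, by simp [Sequent.Repl, Str.Repl, *], .subOr _ _ _ _ _⟩
  case subRexc => exact ⟨_, by simp [Sequent.Repl, Str.Repl, *], .subRexc _ _ _ _ _⟩
  case subImp => exact ⟨_, by simp [Sequent.Repl, Str.Repl, *], .subImp _ _ _ _ _⟩
  case subLexc => exact ⟨_, by simp [Sequent.Repl, Str.Repl, *], .subLexc _ _ _ _ _⟩
  case subLimp => exact ⟨_, by simp [Sequent.Repl, Str.Repl, *], .subLimp _ _ _ _ _⟩
  case cqL => exact ⟨_, by simp [Sequent.Repl, Str.Repl, *], .cqL _ _ _ _ _ ‹_›⟩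
  case cqR => exact ⟨_, by simp [Sequent.Repl, Str.Repl, *], .cqR _ _ _ _ _ ‹_›⟩
  case sqL => exact ⟨_, by simp [Sequent.Repl, Str.Repl, *], .sqL _ _ _ _ _ _ ‹_› ‹_›⟩
  case sqR => exact ⟨_, by simp [Sequent.Repl, Str.Repl, *], .sqR _ _ _ _ _ _ ‹_› ‹_›⟩
  case ccL => exact ⟨_, by simp [Sequent.Repl, Str.Repl, *], .ccL _ _ _ _ _ ‹_›⟩
  case ccR => exact ⟨_, by simp [Sequent.Repl, Str.Repl, *], .ccR _ _ _ _ _ ‹_›⟩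
  case ssL => exact ⟨_, by simp [Sequent.Repl, Str.Repl, *], .ssL _ _ _ _ _⟩
  case ssR => exact ⟨_, by simp [Sequent.Repl, Str.Repl, *], .ssR _ _ _ _ _⟩
  case scL t y s _ _ _ hy hzs _ _ =>
    exact ⟨_, by simp [Sequent.Repl, Str.Repl, *], .scL _ t y s _ _ _ hy hzs⟩
  case scR t y s _ _ _ hy hzs _ _ =>
    exact ⟨_, by simp [Sequent.Repl, Str.Repl, *], .scR _ t y s _ _ _ hy hzs⟩

theorem DoubleLine.exists_repl_up {p c c' : Sequent L} (h : DoubleLine c p)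
    (hc : c.Repl A P c') : ∃ p', p.Repl A P p' ∧ DoubleLine c' p' := by
  obtain ⟨F', X', Y'⟩ := c'
  cases h <;> obtain ⟨hF, hX, hY⟩ := hc <;>
    simp only [Str.Repl] at hF hX hY <;> subst hF <;> (try casesm* _ ∧ _, ∃ _, _) <;>
    subst_vars
  case andImp => exact ⟨_, by simp [Sequent.Repl, Str.Repl, *], .andImp _ _ _ _⟩
  case andLimp => exact ⟨_, by simp [Sequent.Repl, Str.Repl, *], .andLimp _ _ _ _⟩
  case orRexc => exact ⟨_, by simp [Sequent.Repl, Str.Repl, *], .orRexc _ _ _ _⟩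
  case orLexc => exact ⟨_, by simp [Sequent.Repl, Str.Repl, *], .orLexc _ _ _ _⟩
  case cylEx => exact ⟨_, by simp [Sequent.Repl, Str.Repl, *], .cylEx _ _ _ _⟩
  case cylAll => exact ⟨_, by simp [Sequent.Repl, Str.Repl, *], .cylAll _ _ _ _⟩
  case subDia => exact ⟨_, by simp [Sequent.Repl, Str.Repl, *], .subDia _ _ _⟩
  case subBox => exact ⟨_, by simp [Sequent.Repl, Str.Repl, *], .subBox _ _ _⟩
  case necCylTop F x _ => exact ⟨_, by simp [Sequent.Repl, Str.Repl, *], .necCylTop F x _⟩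
  case necCylBot F x _ => exact ⟨_, by simp [Sequent.Repl, Str.Repl, *], .necCylBot F x _⟩
  case necSubTop t _ => exact ⟨_, by simp [Sequent.Repl, Str.Repl, *], .necSubTop t _⟩
  case necSubBot t _ => exact ⟨_, by simp [Sequent.Repl, Str.Repl, *], .necSubBot t _⟩
  case topL => exact ⟨_, by simp [Sequent.Repl, Str.Repl, *], .topL _ _ _⟩
  case botR => exact ⟨_, by simp [Sequent.Repl, Str.Repl, *], .botR _ _ _⟩
  case assocL => exact ⟨_, by simp [Sequent.Repl, Str.Repl, *], .assocL _ _ _ _ _⟩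
  case assocR => exact ⟨_, by simp [Sequent.Repl, Str.Repl, *], .assocR _ _ _ _ _⟩
  case monoCyl => exact ⟨_, by simp [Sequent.Repl, Str.Repl, *], .monoCyl _ _ _ _⟩
  case cylRexc => exact ⟨_, by simp [Sequent.Repl, Str.Repl, *], .cylRexc _ _ _ _ _⟩
  case cylImp => exact ⟨_, by simp [Sequent.Repl, Str.Repl, *], .cylImp _ _ _ _ _⟩
  case cylLexc => exact ⟨_, by simp [Sequent.Repl, Str.Repl, *], .cylLexc _ _ _ _ _⟩
  case cylLimp => exact ⟨_, by simp [Sequent.Repl, Str.Repl, *], .cylLimp _ _ _ _ _⟩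
  case cylAnd => exact ⟨_, by simp [Sequent.Repl, Str.Repl, *], .cylAnd _ _ _ _ _⟩
  case cylOr => exact ⟨_, by simp [Sequent.Repl, Str.Repl, *], .cylOr _ _ _ _ _⟩
  case subAnd => exact ⟨_, by simp [Sequent.Repl, Str.Repl, *], .subAnd _ _ _ _ _⟩
  case subOr => exact ⟨_, by simp [Sequent.Repl, Str.Repl, *], .subOr _ _ _ _ _⟩
  case subRexc => exact ⟨_, by simp [Sequent.Repl, Str.Repl, *], .subRexc _ _ _ _ _⟩
  case subImp => exact ⟨_, by simp [Sequent.Repl, Str.Repl, *], .subImp _ _ _ _ _⟩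
  case subLexc => exact ⟨_, by simp [Sequent.Repl, Str.Repl, *], .subLexc _ _ _ _ _⟩
  case subLimp => exact ⟨_, by simp [Sequent.Repl, Str.Repl, *], .subLimp _ _ _ _ _⟩
  case cqL => exact ⟨_, by simp [Sequent.Repl, Str.Repl, *], .cqL _ _ _ _ _ ‹_›⟩
  case cqR => exact ⟨_, by simp [Sequent.Repl, Str.Repl, *], .cqR _ _ _ _ _ ‹_›⟩
  case sqL t y z _ _ hy hz _ _ =>
    exact ⟨_, by simp [Sequent.Repl, Str.Repl, *], .sqL _ t y z _ _ hy hz⟩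
  case sqR t y z _ _ hy hz _ _ =>
    exact ⟨_, by simp [Sequent.Repl, Str.Repl, *], .sqR _ t y z _ _ hy hz⟩
  case ccL => exact ⟨_, by simp [Sequent.Repl, Str.Repl, *], .ccL _ _ _ _ _ ‹_›⟩
  case ccR => exact ⟨_, by simp [Sequent.Repl, Str.Repl, *], .ccR _ _ _ _ _ ‹_›⟩
  case ssL => exact ⟨_, by simp [Sequent.Repl, Str.Repl, *], .ssL _ _ _ _ _⟩
  case ssR => exact ⟨_, by simp [Sequent.Repl, Str.Repl, *], .ssR _ _ _ _ _⟩
  case scL t y s zs _ _ hy hzs V hV =>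
    -- `V` is the replaced version of the structure under `(ỹ)`; the list `zs` is not determined by
    -- the other side of the rule and is carried over.
    exact ⟨⟨F', Str.cyls zs (.sub t V), Y'⟩, ⟨rfl, Str.repl_cyls.2 ⟨_, ⟨V, hV, rfl⟩, rfl⟩, hY⟩,
      .scL _ t y s zs _ _ hy hzs⟩
  case scR t y s zs _ _ hy hzs V hV =>
    exact ⟨⟨F', X', Str.cyls zs (.sub t V)⟩, ⟨rfl, hX, Str.repl_cyls.2 ⟨_, ⟨V, hV, rfl⟩, rfl⟩⟩,
      .scR _ t y s zs _ _ hy hzs⟩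

end

/-! ### Principal formulas -/

/-- `X ⊢_F A` is the conclusion of an axiom or of a right introduction rule for `A`, with cut-free
provable premises. -/
def PrincipalRight : Fm L → Finset ℕ → Str L .pre → Prop
  | .atom a, _, X => X = .atom a
  | .top F, _, X => X = .top F
  | .bot G, F, X => CutFreeProvable ⟨F, X, .bot G⟩
  | .and A B, F, X => ∃ X₁ X₂, X = .and X₁ X₂ ∧
      CutFreeProvable ⟨F, X₁, .fml A⟩ ∧ CutFreeProvable ⟨F, X₂, .fml B⟩
  | .or A B, F, X => CutFreeProvable ⟨F, X, .or (.fml A) (.fml B)⟩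
  | .imp A B, F, X => CutFreeProvable ⟨F, X, .imp (.fml A) (.fml B)⟩
  | .all y A, F, X => CutFreeProvable ⟨F, X, .all y (.fml A)⟩
  | .ex y A, F, X => ∃ G X₁, F = G.erase y ∧ X = .ex y X₁ ∧ CutFreeProvable ⟨G, X₁, .fml A⟩
  | .cyl x A, F, X => CutFreeProvable ⟨F, X, .cyl x (.fml A)⟩
  | .sub t A, F, X => CutFreeProvable ⟨F, X, .sub t (.fml A)⟩

/-- `A ⊢_F Y` is the conclusion of an axiom or of a left introduction rule for `A`, with cut-free
provable premises. -/
def PrincipalLeft : Fm L → Finset ℕ → Str L .suc → Prop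
  | .atom a, F, Y => CutFreeProvable ⟨F, .atom a, Y⟩
  | .top G, F, Y => CutFreeProvable ⟨F, .top G, Y⟩
  | .bot G, _, Y => Y = .bot G
  | .and A B, F, Y => CutFreeProvable ⟨F, .and (.fml A) (.fml B), Y⟩
  | .or A B, F, Y => ∃ Y₁ Y₂, Y = .or Y₁ Y₂ ∧
      CutFreeProvable ⟨F, .fml A, Y₁⟩ ∧ CutFreeProvable ⟨F, .fml B, Y₂⟩
  | .imp A B, F, Y => ∃ X₁ Y₂, Y = .imp X₁ Y₂ ∧
      CutFreeProvable ⟨F, X₁, .fml A⟩ ∧ CutFreeProvable ⟨F, .fml B, Y₂⟩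
  | .all y A, F, Y => ∃ G Y₁, F = G.erase y ∧ Y = .all y Y₁ ∧ CutFreeProvable ⟨G, .fml A, Y₁⟩
  | .ex y A, F, Y => CutFreeProvable ⟨F, .ex y (.fml A), Y⟩
  | .cyl x A, F, Y => CutFreeProvable ⟨F, .cyl x (.fml A), Y⟩
  | .sub t A, F, Y => CutFreeProvable ⟨F, .sub t (.fml A), Y⟩

section

variable {A : Fm L} {P : (p : Pol) → Str L p → Prop}

/-- One side of `S` is a structure replacing `A`, and the other side is the result of introducing
`A` on the opposite side. -/
def Sequent.ReplPrincipal (A : Fm L) (P : (p : Pol) → Str L p → Prop) (S : Sequent L) : Prop :=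
  P .suc S.con ∧ PrincipalRight A S.ty S.ant ∨ P .pre S.ant ∧ PrincipalLeft A S.ty S.con

/-- Purely structural rules always give the first alternative. An introduction rule does so if its
principal formula is left alone; if that occurrence is itself replaced, `ih` makes the premise
provable with its parametric occurrences already replaced, which is what the principal predicates
require. -/
theorem SingleLine.exists_repl {p c c' : Sequent L} (h : SingleLine p c) (hc : c.Repl A P c')
    (ih : ∀ p', p.Repl A P p' → CutFreeProvable p') :
    (∃ p', p.Repl A P p' ∧ SingleLine p' c') ∨ c'.ReplPrincipal A P := by
  obtain ⟨F', X', Y'⟩ := c'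
  cases h <;> obtain ⟨hF, hX, hY⟩ := hc <;>
    simp only [Str.Repl, Str.repl_cyls, Str.repl_subs_atom] at hF hX hY <;> subst hF <;>
    (try casesm* _ ∧ _, ∃ _, _) <;> subst_vars
  case cadj x _ _ => exact .inl ⟨_, by simp [Sequent.Repl, Str.Repl, *], .cadj _ x _ _⟩
  case sadj t _ _ => exact .inl ⟨_, by simp [Sequent.Repl, Str.Repl, *], .sadj _ t _ _⟩
  case atomStr ss ts a b _ h =>
    exact .inl ⟨_, by simp [Sequent.Repl, Str.repl_subs_atom, *], .atomStr _ ss ts a b _ h⟩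
  case exchL => exact .inl ⟨_, by simp [Sequent.Repl, Str.Repl, *], .exchL _ _ _ _⟩
  case exchR => exact .inl ⟨_, by simp [Sequent.Repl, Str.Repl, *], .exchR _ _ _ _⟩
  case weakL => exact .inl ⟨_, by simp [Sequent.Repl, *], .weakL _ _ _ _⟩
  case weakR => exact .inl ⟨_, by simp [Sequent.Repl, *], .weakR _ _ _ _⟩
  case contrL => exact .inl ⟨_, by simp [Sequent.Repl, Str.Repl, *], .contrL _ _ _⟩
  case contrR => exact .inl ⟨_, by simp [Sequent.Repl, Str.Repl, *], .contrR _ _ _⟩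
  case eqRefl t _ _ => exact .inl ⟨_, by simp [Sequent.Repl, Str.Repl, *], .eqRefl _ t _ _⟩
  case eqRepl t s r y xs ys zs _ hy hxs hys hzs V hV =>
    -- The equation on the left is a structural atom, so only `X` can change, here into `V`.
    exact .inl ⟨⟨F', .cyls xs (.atom (.eq t s)), .cyls ys (.sub (r.cons y t) V)⟩,
      ⟨rfl, .refl _, Str.repl_cyls.2 ⟨_, ⟨V, hV, rfl⟩, rfl⟩⟩,
      .eqRepl _ t s r y xs ys zs _ hy hxs hys hzs⟩
  case grishinL => exact .inl ⟨_, by simp [Sequent.Repl, Str.Repl, *], .grishinL _ _ _ _ _⟩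
  case grishinR => exact .inl ⟨_, by simp [Sequent.Repl, Str.Repl, *], .grishinR _ _ _ _ _⟩
  case monoSub => exact .inl ⟨_, by simp [Sequent.Repl, *], .monoSub _ _ _⟩
  case atomL =>
    rcases hX with rfl | ⟨rfl, hU⟩
    · exact .inl ⟨_, by simp [Sequent.Repl, Str.Repl, *], .atomL _ _ _⟩
    · exact .inr (.inr ⟨hU, ih _ (by simp [Sequent.Repl, Str.Repl, *])⟩)
  case botR =>
    rcases hY with rfl | ⟨rfl, hU⟩
    · exact .inl ⟨_, by simp [Sequent.Repl, Str.Repl, *], .botR _ _⟩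
    · exact .inr (.inl ⟨hU, ih _ (by simp [Sequent.Repl, Str.Repl, *])⟩)
  case topL =>
    rcases hX with rfl | ⟨rfl, hU⟩
    · exact .inl ⟨_, by simp [Sequent.Repl, Str.Repl, *], .topL _ _⟩
    · exact .inr (.inr ⟨hU, ih _ (by simp [Sequent.Repl, Str.Repl, *])⟩)
  case andL =>
    rcases hX with rfl | ⟨rfl, hU⟩
    · exact .inl ⟨_, by simp [Sequent.Repl, Str.Repl, *], .andL _ _ _ _⟩
    · exact .inr (.inr ⟨hU, ih _ (by simp [Sequent.Repl, Str.Repl, *])⟩)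
  case orR =>
    rcases hY with rfl | ⟨rfl, hU⟩
    · exact .inl ⟨_, by simp [Sequent.Repl, Str.Repl, *], .orR _ _ _ _⟩
    · exact .inr (.inl ⟨hU, ih _ (by simp [Sequent.Repl, Str.Repl, *])⟩)
  case impR =>
    rcases hY with rfl | ⟨rfl, hU⟩
    · exact .inl ⟨_, by simp [Sequent.Repl, Str.Repl, *], .impR _ _ _ _⟩
    · exact .inr (.inl ⟨hU, ih _ (by simp [Sequent.Repl, Str.Repl, *])⟩)
  case exL =>
    rcases hX with rfl | ⟨rfl, hU⟩
    · exact .inl ⟨_, by simp [Sequent.Repl, Str.Repl, *], .exL _ _ _ _⟩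
    · exact .inr (.inr ⟨hU, ih _ (by simp [Sequent.Repl, Str.Repl, *])⟩)
  case exR =>
    rcases hY with rfl | ⟨rfl, hU⟩
    · exact .inl ⟨_, by simp [Sequent.Repl, Str.Repl, *], .exR _ _ _ _⟩
    · exact .inr (.inl ⟨hU, ⟨_, _, rfl, rfl, ih _ (by simp [Sequent.Repl, Str.Repl, *])⟩⟩)
  case allL =>
    rcases hX with rfl | ⟨rfl, hU⟩
    · exact .inl ⟨_, by simp [Sequent.Repl, Str.Repl, *], .allL _ _ _ _⟩
    · exact .inr (.inr ⟨hU, ⟨_, _, rfl, rfl, ih _ (by simp [Sequent.Repl, Str.Repl, *])⟩⟩)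
  case allR =>
    rcases hY with rfl | ⟨rfl, hU⟩
    · exact .inl ⟨_, by simp [Sequent.Repl, Str.Repl, *], .allR _ _ _ _⟩
    · exact .inr (.inl ⟨hU, ih _ (by simp [Sequent.Repl, Str.Repl, *])⟩)
  case cylL =>
    rcases hX with rfl | ⟨rfl, hU⟩
    · exact .inl ⟨_, by simp [Sequent.Repl, Str.Repl, *], .cylL _ _ _ _⟩
    · exact .inr (.inr ⟨hU, ih _ (by simp [Sequent.Repl, Str.Repl, *])⟩)
  case cylR =>
    rcases hY with rfl | ⟨rfl, hU⟩
    · exact .inl ⟨_, by simp [Sequent.Repl, Str.Repl, *], .cylR _ _ _ _⟩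
    · exact .inr (.inl ⟨hU, ih _ (by simp [Sequent.Repl, Str.Repl, *])⟩)
  case subL =>
    rcases hX with rfl | ⟨rfl, hU⟩
    · exact .inl ⟨_, by simp [Sequent.Repl, Str.Repl, *], .subL _ _ _ _⟩
    · exact .inr (.inr ⟨hU, ih _ (by simp [Sequent.Repl, Str.Repl, *])⟩)
  case subR =>
    rcases hY with rfl | ⟨rfl, hU⟩
    · exact .inl ⟨_, by simp [Sequent.Repl, Str.Repl, *], .subR _ _ _ _⟩
    · exact .inr (.inl ⟨hU, ih _ (by simp [Sequent.Repl, Str.Repl, *])⟩)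

theorem Binary.exists_repl {p q c c' : Sequent L} (h : Binary p q c) (hc : c.Repl A P c')
    (ihp : ∀ p', p.Repl A P p' → CutFreeProvable p')
    (ihq : ∀ q', q.Repl A P q' → CutFreeProvable q') :
    (∃ p' q', p.Repl A P p' ∧ q.Repl A P q' ∧ Binary p' q' c') ∨ c'.ReplPrincipal A P := by
  obtain ⟨F', X', Y'⟩ := c'
  cases h <;> obtain ⟨hF, hX, hY⟩ := hc <;> simp only [Str.Repl] at hF hX hY <;> subst hF <;>
    (try casesm* _ ∧ _, ∃ _, _) <;> subst_vars
  case andR =>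
    rcases hY with rfl | ⟨rfl, hU⟩
    · exact .inl ⟨_, _, by simp [Sequent.Repl, Str.Repl, *],
        by simp [Sequent.Repl, Str.Repl, *], .andR _ _ _ _ _⟩
    · exact .inr (.inl ⟨hU, _, _, rfl, ihp _ (by simp [Sequent.Repl, Str.Repl, *]),
        ihq _ (by simp [Sequent.Repl, Str.Repl, *])⟩)
  case orL =>
    rcases hX with rfl | ⟨rfl, hU⟩
    · exact .inl ⟨_, _, by simp [Sequent.Repl, Str.Repl, *],
        by simp [Sequent.Repl, Str.Repl, *], .orL _ _ _ _ _⟩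
    · exact .inr (.inr ⟨hU, _, _, rfl, ihp _ (by simp [Sequent.Repl, Str.Repl, *]),
        ihq _ (by simp [Sequent.Repl, Str.Repl, *])⟩)
  case impL =>
    rcases hX with rfl | ⟨rfl, hU⟩
    · exact .inl ⟨_, _, by simp [Sequent.Repl, Str.Repl, *],
        by simp [Sequent.Repl, Str.Repl, *], .impL _ _ _ _ _⟩
    · exact .inr (.inr ⟨hU, _, _, rfl, ihp _ (by simp [Sequent.Repl, Str.Repl, *]),
        ihq _ (by simp [Sequent.Repl, Str.Repl, *])⟩)

theorem Ax.repl {c c' : Sequent L} (h : Ax c) (hc : c.Repl A P c') :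
    Ax c' ∨ c'.ReplPrincipal A P := by
  obtain ⟨F', X', Y'⟩ := c'
  cases h <;> obtain ⟨hF, hX, hY⟩ := hc <;> simp only [Str.Repl] at hF hX hY <;> subst hF
  case id =>
    subst hX
    rcases hY with rfl | ⟨rfl, hU⟩
    · exact .inl (.id _ _)
    · exact .inr (.inl ⟨hU, rfl⟩)
  case botL =>
    subst hY
    rcases hX with rfl | ⟨rfl, hU⟩
    · exact .inl (.botL _)
    · exact .inr (.inr ⟨hU, rfl⟩)
  case topR =>
    subst hX
    rcases hY with rfl | ⟨rfl, hU⟩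
    · exact .inl (.topR _)
    · exact .inr (.inl ⟨hU, rfl⟩)

/-- Parametric occurrences of `A` may be replaced in cut-free derivations, provided that this is
possible where `A` is principal. -/
theorem CutFreeProvable.repl {H : Finset ℕ} (hA : A.HasTy H) (hP : ∀ p U, P p U → U.HasTy H)
    (hprin : ∀ S : Sequent L, S.WellTyped → S.ReplPrincipal A P → CutFreeProvable S)
    {S : Sequent L} (d : CutFreeProvable S) {S' : Sequent L} (hS : S.Repl A P S') :
    CutFreeProvable S' := by
  -- Every rule instance of the new proof has to be well-typed.
  have wt' {c c' : Sequent L} (wt : c.WellTyped) (hc : c.Repl A P c') : c'.WellTyped := by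
    rw [Sequent.WellTyped, hc.1]
    exact ⟨hc.2.1.hasTy hA hP wt.1, hc.2.2.hasTy hA hP wt.2⟩
  induction d generalizing S' with
  | ax h wt => exact (h.repl hS).elim (.ax · (wt' wt hS)) (hprin _ (wt' wt hS))
  | unary h wt _ ih =>
    rcases h with h | h | h
    · rcases h.exists_repl hS fun _ => ih with ⟨p', hp, h⟩ | h
      · exact (ih hp).single h (wt' wt hS)
      · exact hprin _ (wt' wt hS) h
    · obtain ⟨p', hp, h⟩ := h.exists_repl_down hS
      exact (ih hp).down h (wt' wt hS)
    · obtain ⟨p', hp, h⟩ := h.exists_repl_up hS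
      exact (ih hp).up h (wt' wt hS)
  | binary h wt _ _ ihp ihq =>
    rcases h.exists_repl hS (fun _ => ihp) fun _ => ihq with ⟨p', q', hp, hq, h⟩ | h
    · exact .binary h (wt' wt hS) (ihp hp) (ihq hq)
    · exact hprin _ (wt' wt hS) h

end

/-! ### Cut elimination -/

/-- Cuts on `A` are admissible in the calculus without cut. -/
def CutAdmissible (A : Fm L) : Prop :=
  ∀ ⦃F : Finset ℕ⦄ ⦃X : Str L .pre⦄ ⦃Y : Str L .suc⦄, CutFreeProvable ⟨F, X, .fml A⟩ →
    CutFreeProvable ⟨F, .fml A, Y⟩ → CutFreeProvable ⟨F, X, Y⟩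

/-- Two successive replacements, in the proof of `X ⊢ A` and then in that of `A ⊢ Y`, push the cut
up to where `A` is principal on both sides. -/
theorem CutAdmissible.of_principal {A : Fm L}
    (hprin : ∀ (F : Finset ℕ) (X : Str L .pre) (Y : Str L .suc), A.HasTy F → X.HasTy F →
      Y.HasTy F → PrincipalRight A F X → PrincipalLeft A F Y → CutFreeProvable ⟨F, X, Y⟩) :
    CutAdmissible A := by
  intro F X Y hl hr
  have hA : A.HasTy F := hl.wellTyped.2
  have hY : Y.HasTy F := hr.wellTyped.2
  -- Only occurrences in succedent position may be replaced. Since `Repl` does not force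
  -- replacement, copies of `A` inside `X` stay.
  refine hl.repl (A := A) (P := fun p U => p = .suc ∧ HEq U Y) hA ?_ ?_
    ⟨rfl, .refl X, .inr ⟨rfl, rfl, .rfl⟩⟩
  · rintro p U ⟨rfl, h⟩
    exact eq_of_heq h ▸ hY
  rintro ⟨F', X', Y'⟩ wt (⟨⟨-, h⟩, h'⟩ | ⟨⟨h, -⟩, -⟩)
  swap
  · cases h
  obtain rfl : Y' = Y := eq_of_heq h
  -- Types vary along a derivation, but `Y` has only one.
  obtain rfl : F' = F := wt.2.unique hY
  -- `A` is now principal on the right in `X' ⊢ A`; the second proof is rebuilt with `X'` for the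
  -- precedent `A`.
  refine hr.repl (A := A) (P := fun p U => p = .pre ∧ HEq U X') hA ?_ ?_
    ⟨rfl, .inr ⟨rfl, rfl, .rfl⟩, .refl _⟩
  · rintro p U ⟨rfl, h⟩
    exact eq_of_heq h ▸ wt.1
  rintro ⟨G, X'', Y''⟩ wt'' (⟨⟨h, -⟩, -⟩ | ⟨⟨-, h⟩, h''⟩)
  · cases h
  obtain rfl : X'' = X' := eq_of_heq h
  obtain rfl : G = F' := wt''.1.unique wt.1
  exact hprin _ _ _ hA wt''.1 wt''.2 h' h''

/-- For `x ∉ F` the type `F.erase x` of the display postulate is `F` itself, so the rule becomes the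
adjunction between `⟨x⟩` and `(x̃)`. -/
theorem CutFreeProvable.cylEx_iff {F : Finset ℕ} {x : ℕ} (hx : x ∉ F) {X : Str L .pre}
    {Y : Str L .suc} :
    CutFreeProvable ⟨insert x F, X, .cyl x Y⟩ ↔ CutFreeProvable ⟨F, .ex x X, Y⟩ := by
  have hF := Finset.erase_insert hx
  have rule := DoubleLine.cylEx F x X Y
  rw [Finset.erase_eq_of_notMem hx] at rule
  refine ⟨fun d => d.down rule ⟨⟨hx, d.wellTyped.1⟩, hF ▸ d.wellTyped.2.2⟩, fun d =>
    d.up rule ⟨d.wellTyped.1.2, Finset.mem_insert_self _ _, hF.symm ▸ d.wellTyped.2⟩⟩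

theorem CutFreeProvable.cylAll_iff {F : Finset ℕ} {x : ℕ} (hx : x ∉ F) {X : Str L .pre}
    {Y : Str L .suc} :
    CutFreeProvable ⟨insert x F, .cyl x X, Y⟩ ↔ CutFreeProvable ⟨F, X, .all x Y⟩ := by
  have hF := Finset.erase_insert hx
  have rule := DoubleLine.cylAll F x Y X
  rw [Finset.erase_eq_of_notMem hx] at rule
  refine ⟨fun d => d.down rule ⟨hF ▸ d.wellTyped.1.2, hx, d.wellTyped.2⟩, fun d =>
    d.up rule ⟨⟨Finset.mem_insert_self _ _, hF.symm ▸ d.wellTyped.1⟩, d.wellTyped.2.2⟩⟩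

open CutFreeProvable in
theorem cutAdmissible (A : Fm L) : CutAdmissible A := by
  induction A with
  | atom a =>
    refine .of_principal fun F X Y _ _ _ hl hr => ?_
    obtain rfl : X = _ := hl
    exact hr
  | top G =>
    refine .of_principal fun F X Y _ _ _ hl hr => ?_
    obtain rfl : X = _ := hl
    exact hr
  | bot G =>
    refine .of_principal fun F X Y _ _ _ hl hr => ?_
    obtain rfl : Y = _ := hr
    exact hl
  | and A B ihA ihB =>
    refine .of_principal fun F X Y hA hX hY hl hr => ?_
    obtain ⟨X₁, X₂, rfl, hl₁, hl₂⟩ := hl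
    -- Display `B`, cut on it, restore the conjunction, then do the same for `A`.
    have h₁ := ihB hl₂ (hr.down (.andImp _ _ _ _) ⟨hA.2, hA.1, hY⟩)
    have h₂ := h₁.up (.andImp _ _ _ _) ⟨⟨hA.1, hX.2⟩, hY⟩
    have h₃ := ihA hl₁ (h₂.down (.andLimp _ _ _ _) ⟨hA.1, hY, hX.2⟩)
    exact h₃.up (.andLimp _ _ _ _) ⟨hX, hY⟩
  | or A B ihA ihB =>
    refine .of_principal fun F X Y hA hX hY hl hr => ?_
    obtain ⟨Y₁, Y₂, rfl, hr₁, hr₂⟩ := hr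
    have h₁ := ihB (hl.down (.orRexc _ _ _ _) ⟨⟨hA.1, hX⟩, hA.2⟩) hr₂
    have h₂ := h₁.up (.orRexc _ _ _ _) ⟨hX, hA.1, hY.2⟩
    have h₃ := ihA (h₂.down (.orLexc _ _ _ _) ⟨⟨hX, hY.2⟩, hA.1⟩) hr₁
    exact h₃.up (.orLexc _ _ _ _) ⟨hX, hY⟩
  | imp A B ihA ihB =>
    refine .of_principal fun F X Y hA hX hY hl hr => ?_
    obtain ⟨X₁, Y₂, rfl, hr₁, hr₂⟩ := hr
    have h₁ := ihB (hl.up (.andImp _ _ _ _) ⟨⟨hA.1, hX⟩, hA.2⟩) hr₂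
    have h₂ := ihA hr₁ (h₁.down (.andLimp _ _ _ _) ⟨hA.1, hY.2, hX⟩)
    exact (h₂.up (.andLimp _ _ _ _) ⟨⟨hY.1, hX⟩, hY.2⟩).down (.andImp _ _ _ _) ⟨hX, hY⟩
  | all y A ih =>
    refine .of_principal fun F X Y hA hX hY hl hr => ?_
    obtain ⟨G, Y₁, hG, rfl, hr⟩ := hr
    -- `F = G.erase y` would also allow `y ∉ G`; the type of `A` decides.
    obtain rfl : G = insert y F := Fm.HasTy.unique hr.wellTyped.1 hA.2
    exact (cylAll_iff hA.1).1 (ih ((cylAll_iff hA.1).2 hl) hr)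
  | ex y A ih =>
    refine .of_principal fun F X Y hA hX hY hl hr => ?_
    obtain ⟨G, X₁, hG, rfl, hl⟩ := hl
    obtain rfl : G = insert y F := Fm.HasTy.unique hl.wellTyped.2 hA.2
    exact (cylEx_iff hA.1).1 (ih hl ((cylEx_iff hA.1).2 hr))
  | cyl x A ih =>
    refine .of_principal fun F X Y hA hX hY hl hr => ?_
    obtain ⟨G, hG, rfl⟩ : ∃ G, x ∉ G ∧ F = insert x G :=
      ⟨F.erase x, F.notMem_erase x, (Finset.insert_erase hA.1).symm⟩
    -- The cut on `A` gives `⟨x⟩X ⊢ [x]Y`, hence `(x̃)⟨x⟩X ⊢ Y`, and `cadj` removes the prefix.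
    exact ((cylAll_iff hG).2 (ih ((cylEx_iff hG).1 hl) ((cylAll_iff hG).1 hr))).single
      (.cadj _ _ _ _) ⟨hX, hY⟩
  | sub t A ih =>
    refine .of_principal fun F X Y hA hX hY hl hr => ?_
    obtain rfl := hA.1
    have h₁ := hl.down (.subDia _ _ _) ⟨⟨rfl, hX⟩, hA.2⟩
    have h₂ := hr.down (.subBox _ _ _) ⟨hA.2, rfl, hY⟩
    -- Likewise from `⟨t⟩X ⊢ A` and `A ⊢ [t]Y`, with `sadj` removing `(t̃)⟨t⟩`.
    exact ((ih h₁ h₂).up (.subBox _ _ _) ⟨⟨rfl, rfl, hX⟩, hY⟩).single (.sadj _ _ _ _) ⟨hX, hY⟩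

theorem Derivation.cutFreeProvable {S : Sequent L} (d : Derivation S) : CutFreeProvable S := by
  induction d with
  | ax h wt => exact .ax h wt
  | unary h wt _ ih => exact .unary h wt ih
  | binary h wt _ _ ihd ihe => exact .binary h wt ihd ihe
  | cut A _ _ ihd ihe => exact cutAdmissible A ihd ihe

/-! ### The subformula property -/

theorem Fm.mem_subformulas_self (A : Fm L) : A ∈ A.subformulas := by
  cases A <;> simp [Fm.subformulas]

theorem Fm.subformulas_trans {A B C : Fm L} (hAB : A ∈ B.subformulas) (hBC : B ∈ C.subformulas) :
    A ∈ C.subformulas := by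
  induction C with
  | atom | top | bot =>
    obtain rfl : B = _ := hBC
    exact hAB
  | and C D ihC ihD | or C D ihC ihD | imp C D ihC ihD =>
    rcases hBC with (rfl | h) | h
    · exact hAB
    · exact .inl (.inr (ihC h))
    · exact .inr (ihD h)
  | all y C ih | ex y C ih | cyl x C ih | sub t C ih =>
    rcases hBC with rfl | h
    · exact hAB
    · exact .inr (ih h)

theorem Str.formulas_cyls {p : Pol} (xs : List ℕ) (X : Str L p) :
    (cyls xs X).formulas = X.formulas := by
  induction xs with
  | nil => rfl
  | cons x xs ih => exact ih

theorem Str.formulas_subs {p : Pol} (ts : List (TSeq L)) (X : Str L p) :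
    (subs ts X).formulas = X.formulas := by
  induction ts with
  | nil => rfl
  | cons t ts ih => exact ih

/-- The subformulas of the formulas occurring in a sequent. -/
def Sequent.subformulas (S : Sequent L) : Set (Fm L) := {A | ∃ B ∈ S.formulas, A ∈ B.subformulas}

theorem Sequent.formulas_subset_subformulas (S : Sequent L) : S.formulas ⊆ S.subformulas :=
  fun A hA => ⟨A, hA, A.mem_subformulas_self⟩

theorem Sequent.subformulas_subset {S T : Sequent L} (h : S.formulas ⊆ T.subformulas) :
    S.subformulas ⊆ T.subformulas := by
  rintro A ⟨B, hB, hA⟩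
  obtain ⟨C, hC, hBC⟩ := h hB
  exact ⟨C, hC, Fm.subformulas_trans hA hBC⟩

/-- Invertible rules only rearrange structures and neither lose nor create formulas, so they are
harmless in both directions. -/
theorem DoubleLine.formulas_eq {p c : Sequent L} (h : DoubleLine p c) :
    p.formulas = c.formulas := by
  cases h <;> simp [Sequent.formulas, Str.formulas, Str.formulas_cyls, Set.union_assoc,
    Set.union_comm, Set.union_left_comm]

theorem SingleLine.formulas_subset {p c : Sequent L} (h : SingleLine p c) :
    p.formulas ⊆ c.subformulas := by
  intro C hC
  cases h <;> simp only [Sequent.formulas, Sequent.subformulas, Str.formulas, Str.formulas_cyls,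
    Str.formulas_subs, Set.mem_union, Set.mem_singleton_iff, Set.mem_ofPred_eq] at hC ⊢ <;>
    grind [Fm.mem_subformulas_self, Fm.subformulas]

theorem Binary.formulas_subset {p q c : Sequent L} (h : Binary p q c) :
    p.formulas ∪ q.formulas ⊆ c.subformulas := by
  intro C hC
  cases h <;> simp only [Sequent.formulas, Sequent.subformulas, Str.formulas, Set.mem_union,
    Set.mem_singleton_iff, Set.mem_ofPred_eq] at hC ⊢ <;>
    grind [Fm.mem_subformulas_self, Fm.subformulas]

theorem Derivation.CutFree.formulas_subset {S : Sequent L} {d : Derivation S} (hd : d.CutFree) :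
    ∀ T ∈ d.sequents, T.formulas ⊆ S.subformulas := by
  induction d with
  | @ax S h wt =>
    intro T hT
    rw [show T = S from hT]
    exact S.formulas_subset_subformulas
  | @unary p S h wt d ih =>
    rintro T (hT | hT)
    · rw [show T = S from hT]
      exact S.formulas_subset_subformulas
    refine (ih hd T hT).trans (Sequent.subformulas_subset ?_)
    rcases h with h | h | h
    · exact h.formulas_subset
    · exact h.formulas_eq ▸ S.formulas_subset_subformulas
    · exact h.formulas_eq ▸ S.formulas_subset_subformulas
  | @binary p q S h wt d e ihd ihe =>
    have hpq := Set.union_subset_iff.1 h.formulas_subset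
    rintro T ((hT | hT) | hT)
    · rw [show T = S from hT]
      exact S.formulas_subset_subformulas
    · exact (ihd hd.1 T hT).trans (Sequent.subformulas_subset hpq.1)
    · exact (ihe hd.2 T hT).trans (Sequent.subformulas_subset hpq.2)
  | cut => exact hd.elim

end DFO

theorem mainTheorem4 (L : FirstOrder.Language.{u, v}) :
    (∀ (S : DFO.Sequent L), DFO.Derivation S → ∃ d : DFO.Derivation S, d.CutFree) ∧
    (∀ (S : DFO.Sequent L) (d : DFO.Derivation S), d.CutFree → d.HasSubformulaProperty) :=
  ⟨fun _ d => d.cutFreeProvable.exists_derivation, fun _ _ hd => hd.formulas_subset⟩
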